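/- Let $\beta\ge 2$ be an integer and let $\xi$ be a rational number. For real $t$ put $\langle t\rangle=\{t\}$ if $t\notin\mathbb Z$ and $\langle t\rangle=1$ if $t\in\mathbb Z$, and let $\overline T_\beta(x)=\langle\beta x\rangle$ for $x\in[0,1]$. The $\overline\beta$-expansion of $x\in[0,1]$ is the sequence $(x_i)_{i\ge1}$ with $x_i=\lceil\beta\,\overline T_\beta^{\,i-1}(x)\rceil-1$, and $\mathrm{Diam}_\beta(x)=\sup_{n\ge0}\overline T_\beta^{\,n}(x)-\inf_{n\ge0}\overline T_\beta^{\,n}(x)$. A mechanical word of slope $\alpha\ge0$ is an infinite word whose $n$-th letter ($n\ge0$) is $\lfloor\alpha(n+1)+\rho\rfloor-\lfloor\alpha n+\rho\rfloor$ for all $n$, or $\lceil\alpha(n+1)+\rho\rceil-\lceil\alpha n+\rho\rceil$ for all $n$, with some fixed $\rho\in[0,1]$. An infinite word in exactly two letters $a,b$ is balanced if the numbers of occurrences of $b$ in any two factors of equal length differ by at most $1$; it is recurrent if each of its finite factors occurs in it infinitely often. A skew word of slope $\alpha\in\mathbb Q$ is a balanced, non-recurrent infinite word which becomes a mechanical word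 of slope $\alpha$ after deletion of some nonempty finite prefix. Suppose that $\mathrm{Diam}_\beta(\{\xi\})\le 1/\beta$. Then one of the following holds. (a) The $\overline\beta$-expansion of $\{\xi\}$ is a mechanical word $(e_1\cdots e_q)^\omega$ of some rational slope $p/q\le\beta-1$, where $q\ge1$ and $\gcd(p,q)=1$, and $$\xi=\lfloor\xi\rfloor+\frac{e_1\beta^{q-1}+e_2\beta^{q-2}+\cdots+e_q}{\beta^q-1}.$$ (b) The $\overline\beta$-expansion of $\{\xi\}$ is a skew word $e_1\cdots e_m(e_{m+1}\cdots e_{m+q})^\omega$ of some rational slope $p/q\le\beta-1$, where $m,q\ge1$ and $\gcd(p,q)=1$, and $$\xi=\lfloor\xi\rfloor+\frac{e_1\beta^{m+q-1}+e_2\beta^{m+q-2}+\cdots+e_{m+q}-(e_1\beta^{m-1}+e_2\beta^{m-2}+\cdots+e_m)}{\beta^m(\beta^q-1)}.$$ -/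

import Mathlib

noncomputable section

/-- `⟨t⟩`: the fractional part of `t` if `t` is not an integer, and `1` if `t` is an integer. -/
def upperFract (t : ℝ) : ℝ := if Int.fract t = 0 then 1 else Int.fract t

/-- The transformation `x ↦ ⟨β x⟩`; on `[0,1]` it takes values in `(0,1]`. -/
def betaBarMap (β x : ℝ) : ℝ := upperFract (β * x)

/-- The `β̄`-expansion of `x ∈ [0,1]`. The digit written `x_i` (`i ≥ 1`) is
the value of the sequence at `i - 1`. -/
def betaBarExpansion (β x : ℝ) (n : ℕ) : ℤ := ⌈β * (betaBarMap β)^[n] x⌉ - 1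

/-- The diameter of the orbit `x, T x, T² x, …` of `x ∈ [0,1]` under `T = betaBarMap β`. -/
def orbitDiam (β x : ℝ) : ℝ :=
  (⨆ n : ℕ, (betaBarMap β)^[n] x) - ⨅ n : ℕ, (betaBarMap β)^[n] x

/-- The lower mechanical word of slope `α` and intercept `ρ`. -/
def lowerMechanical (α ρ : ℝ) (n : ℕ) : ℤ := ⌊α * (n + 1) + ρ⌋ - ⌊α * n + ρ⌋

/-- The upper mechanical word of slope `α` and intercept `ρ`. -/
def upperMechanical (α ρ : ℝ) (n : ℕ) : ℤ := ⌈α * (n + 1) + ρ⌉ - ⌈α * n + ρ⌉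

/-- `w` is a (lower or upper) mechanical word of slope `α`. -/
def IsMechanicalWord (w : ℕ → ℤ) (α : ℝ) : Prop :=
  0 ≤ α ∧ ∃ ρ ∈ Set.Icc (0 : ℝ) 1, w = lowerMechanical α ρ ∨ w = upperMechanical α ρ

/-- The number of occurrences of the letter `c` in the factor `w i, …, w (i + n - 1)`. -/
def letterCount (w : ℕ → ℤ) (c : ℤ) (i n : ℕ) : ℕ :=
  ((Finset.range n).filter fun k => w (i + k) = c).card

/-- A balanced binary infinite word: exactly two letters `a`, `b` appear in it, and the numbers of
occurrences of `b` in two factors of the same length differ by at most one. -/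
def IsBalancedWord (w : ℕ → ℤ) : Prop :=
  ∃ a b : ℤ, a ≠ b ∧ Set.range w = {a, b} ∧
    ∀ i j n : ℕ, |(letterCount w b i n : ℤ) - (letterCount w b j n : ℤ)| ≤ 1

/-- A recurrent infinite word: each of its finite factors occurs in it infinitely often. -/
def IsRecurrentWord (w : ℕ → ℤ) : Prop :=
  ∀ i n N : ℕ, ∃ j ≥ N, ∀ k < n, w (j + k) = w (i + k)

/-- A skew word of slope `α`: a non-recurrent balanced infinite word which, after a nonempty
prefix, is a mechanical word of rational slope `α`. -/
def IsSkewWord (w : ℕ → ℤ) (α : ℚ) : Prop :=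
  IsBalancedWord w ∧ ¬ IsRecurrentWord w ∧
    ∃ k : ℕ, 1 ≤ k ∧ IsMechanicalWord (fun n => w (k + n)) (α : ℝ)

end

/-! Write `x_n` for the orbit of `{ξ}` and `e_n` for its digits, so `x_(n+1) = β x_n - e_n`. If `e_j
< e_i`, the diameter bound gives `x_(i+1) - x_(j+1) ≤ β · (1/β) - 1 = 0`. The digit is monotone in
the point, so at the first later disagreement the digit on the `i` side is the smaller one
(`not_digit_lt_of_agree`). Every excess is thus compensated, and the digit word is balanced
(`factorSum_betaBarExpansion_sub_le_one`). Rationality makes the orbit eventually periodic. A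
periodic balanced word is mechanical, because its partial sums stay within a band of width less than
1 around a line. If the whole word is periodic this is case (a); otherwise only a tail is, the word
is not recurrent, and this is case (b). -/

/-- The sum of the letters of the factor `w i, …, w (i + n - 1)`. -/
def factorSum (w : ℕ → ℤ) (i n : ℕ) : ℤ := ∑ t ∈ Finset.range n, w (i + t)

theorem factorSum_add (w : ℕ → ℤ) (i m n : ℕ) :
    factorSum w i (m + n) = factorSum w i m + factorSum w (i + m) n := by
  simp only [factorSum, Finset.sum_range_add, add_assoc]

theorem factorSum_shift (w : ℕ → ℤ) (k i n : ℕ) :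
    factorSum (fun t => w (k + t)) i n = factorSum w (k + i) n := by
  simp only [factorSum, add_assoc]

/-! ### Periodic balanced words are mechanical. -/

section Periodic

variable {w : ℕ → ℤ} {Q : ℕ}

theorem factorSum_period (hper : ∀ n, w (n + Q) = w n) (i : ℕ) :
    factorSum w i Q = factorSum w 0 Q := by
  induction i with
  | zero => rfl
  | succ i ih =>
    have h1 : factorSum w i (1 + Q) = factorSum w i 1 + factorSum w (i + 1) Q :=
      factorSum_add w i 1 Q
    have h2 : factorSum w i (Q + 1) = factorSum w i Q + factorSum w (i + Q) 1 :=
      factorSum_add w i Q 1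
    have h3 : factorSum w (i + Q) 1 = factorSum w i 1 := by simp [factorSum, hper]
    rw [add_comm 1 Q] at h1
    linarith

theorem sum_factorSum_period (hper : ∀ n, w (n + Q) = w n) (l : ℕ) :
    ∑ i ∈ Finset.range Q, factorSum w i l = l * factorSum w 0 Q := by
  unfold factorSum
  rw [Finset.sum_comm]
  have : ∀ t ∈ Finset.range l, ∑ i ∈ Finset.range Q, w (i + t) = factorSum w 0 Q := by
    intro t _
    rw [← factorSum_period hper t]
    exact Finset.sum_congr rfl fun i _ => by rw [add_comm]
  rw [Finset.sum_congr rfl this]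
  simp [factorSum]

/-- In a periodic balanced word the factor sums are at distance less than `1` from the mean. -/
theorem factorSum_lt_mean (hQ : 1 ≤ Q) (hper : ∀ n, w (n + Q) = w n)
    (hbal : ∀ i j n, factorSum w i n - factorSum w j n ≤ 1) (i l : ℕ) :
    Q * factorSum w i l < l * factorSum w 0 Q + Q ∧
      l * factorSum w 0 Q < Q * factorSum w i l + Q := by
  have hmem : i % Q ∈ Finset.range Q := Finset.mem_range.2 (Nat.mod_lt _ hQ)
  have hmod : factorSum w (i % Q) l = factorSum w i l := by
    have hp : Function.Periodic (fun i => factorSum w i l) Q := fun i => by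
      refine Finset.sum_congr rfl fun t _ => ?_
      rw [show i + Q + t = i + t + Q by ring, hper]
    exact hp.map_mod_nat i
  rw [← sum_factorSum_period hper l]
  constructor
  -- Averaging over one period; the term `j = i % Q` makes the inequality strict.
  · have h : ∑ j ∈ Finset.range Q, (factorSum w i l - 1) <
        ∑ j ∈ Finset.range Q, factorSum w j l :=
      Finset.sum_lt_sum (fun j _ => by linarith [hbal i j l])
        ⟨_, hmem, by rw [hmod]; linarith⟩
    rw [Finset.sum_const, Finset.card_range, nsmul_eq_mul] at h
    linarith
  · have h : ∑ j ∈ Finset.range Q, factorSum w j l <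
        ∑ j ∈ Finset.range Q, (factorSum w i l + 1) :=
      Finset.sum_lt_sum (fun j _ => by linarith [hbal j i l])
        ⟨_, hmem, by rw [hmod]; linarith⟩
    rw [Finset.sum_const, Finset.card_range, nsmul_eq_mul] at h
    linarith

/-- The deviation of the partial sums from the line of slope `α` is periodic and oscillates by less
than 1, so its maximum serves as `ρ`. -/
theorem exists_floor_eq_factorSum (hQ : 1 ≤ Q) (hper : ∀ n, w (n + Q) = w n)
    (hbal : ∀ i j n, factorSum w i n - factorSum w j n ≤ 1) :
    ∃ ρ ∈ Set.Icc (0 : ℝ) 1, ∀ n : ℕ,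
      ⌊(factorSum w 0 Q : ℝ) / Q * n + ρ⌋ = factorSum w 0 n := by
  set α : ℝ := (factorSum w 0 Q : ℝ) / Q with hα
  have hQ0 : (0 : ℝ) < Q := by exact_mod_cast hQ
  have hαQ : α * Q = factorSum w 0 Q := by rw [hα]; field_simp
  let f : ℕ → ℝ := fun n => factorSum w 0 n - α * n
  have hfper : Function.Periodic f Q := fun n => by
    simp only [f, factorSum_add, zero_add, factorSum_period hper n]
    push_cast
    linarith
  obtain ⟨k, -, hk⟩ := Finset.exists_max_image (Finset.range Q) f
    ⟨0, Finset.mem_range.2 hQ⟩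
  have hmax : ∀ n, f n ≤ f k := fun n => by
    rw [← hfper.map_mod_nat n]
    exact hk _ (Finset.mem_range.2 (Nat.mod_lt _ hQ))
  have hlt : ∀ n, f k < f n + 1 := fun n => by
    rcases le_total n k with h | h
    · obtain ⟨l, rfl⟩ := Nat.exists_eq_add_of_le h
      have h1 := (factorSum_lt_mean hQ hper hbal n l).1
      have h2 : (Q : ℝ) * factorSum w n l < l * factorSum w 0 Q + Q := by exact_mod_cast h1
      rw [← hαQ] at h2
      have h3 : (factorSum w n l : ℝ) < l * α + 1 := by
        refine lt_of_mul_lt_mul_left ?_ hQ0.le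
        linarith
      simp only [f, factorSum_add, zero_add]
      push_cast
      linarith
    · obtain ⟨l, rfl⟩ := Nat.exists_eq_add_of_le h
      have h1 := (factorSum_lt_mean hQ hper hbal k l).2
      have h2 : (l : ℝ) * factorSum w 0 Q < Q * factorSum w k l + Q := by exact_mod_cast h1
      rw [← hαQ] at h2
      have h3 : l * α < (factorSum w k l : ℝ) + 1 := by
        refine lt_of_mul_lt_mul_left ?_ hQ0.le
        linarith
      simp only [f, factorSum_add, zero_add]
      push_cast
      linarith
  have hf0 : f 0 = 0 := by simp [f, factorSum]
  refine ⟨f k, ⟨hf0 ▸ hmax 0, by linarith [hlt 0]⟩, fun n => ?_⟩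
  rw [Int.floor_eq_iff]
  have h1 := hmax n
  have h2 := hlt n
  constructor
  · change (factorSum w 0 n : ℝ) - α * n ≤ f k at h1
    linarith
  · change f k < (factorSum w 0 n : ℝ) - α * n + 1 at h2
    linarith

/-- A periodic balanced word with letters in `[0, B]` is mechanical, and the denominator of its
slope is a period. -/
theorem isMechanicalWord_of_periodic_of_balanced {B : ℕ} (hQ : 1 ≤ Q)
    (hper : ∀ n, w (n + Q) = w n)
    (hbal : ∀ i j n, factorSum w i n - factorSum w j n ≤ 1)
    (h0 : ∀ n, 0 ≤ w n) (hB : ∀ n, w n ≤ B) :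
    ∃ p q : ℕ, 1 ≤ q ∧ p.Coprime q ∧ (p : ℚ) / (q : ℚ) ≤ B ∧
      (∀ n, w (n + q) = w n) ∧ IsMechanicalWord w (((p : ℚ) / (q : ℚ) : ℚ) : ℝ) := by
  obtain ⟨ρ, hρ, hfloor⟩ := exists_floor_eq_factorSum hQ hper hbal
  have hP0 : 0 ≤ factorSum w 0 Q := Finset.sum_nonneg fun _ _ => h0 _
  have hPB : factorSum w 0 Q ≤ Q * B := by
    simpa [factorSum] using Finset.sum_le_card_nsmul (Finset.range Q) (fun t => w (0 + t)) B fun _ _ => hB _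
  set α : ℚ := (factorSum w 0 Q : ℚ) / Q with hα
  have hQ0 : (0 : ℚ) < Q := by exact_mod_cast hQ
  have hα0 : 0 ≤ α := div_nonneg (by exact_mod_cast hP0) hQ0.le
  have hαB : α ≤ B := by
    rw [hα, div_le_iff₀ hQ0, mul_comm]
    exact_mod_cast hPB
  have hnum : ((α.num.toNat : ℕ) : ℤ) = α.num := Int.toNat_of_nonneg (Rat.num_nonneg.2 hα0)
  have hnumQ : ((α.num.toNat : ℕ) : ℚ) = α.num := by exact_mod_cast hnum
  have hpq : ((α.num.toNat : ℕ) : ℚ) / (α.den : ℚ) = α := by rw [hnumQ, Rat.num_div_den]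
  have hw : w = lowerMechanical (α : ℝ) ρ := by
    funext n
    have hc : (α : ℝ) = (factorSum w 0 Q : ℝ) / Q := by rw [hα]; push_cast; rfl
    have h1 := hfloor (n + 1)
    have h2 := hfloor n
    push_cast at h1
    simp only [lowerMechanical]
    rw [hc, h1, h2, factorSum_add]
    simp [factorSum]
  refine ⟨α.num.toNat, α.den, α.pos, ?_, by rwa [hpq], fun n => ?_, ?_⟩
  · have := α.reduced
    rwa [← hnum, Int.natAbs_natCast] at this
  -- A shift by the denominator adds the same integer inside both floors.
  · have hden : (α : ℝ) * α.den = (α.num : ℤ) := by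
      exact_mod_cast Rat.mul_den_eq_num α
    rw [hw]
    simp only [lowerMechanical]
    push_cast
    rw [show (α : ℝ) * (n + α.den + 1) + ρ = α * (n + 1) + ρ + (α.num : ℤ) by
        rw [← hden]; ring,
      show (α : ℝ) * (n + α.den) + ρ = α * n + ρ + (α.num : ℤ) by rw [← hden]; ring,
      Int.floor_add_intCast, Int.floor_add_intCast]
    ring
  · rw [hpq]
    exact ⟨by exact_mod_cast hα0, ρ, hρ, Or.inl hw⟩

end Periodic

/-! ### Recurrence and balance of words. -/

theorem periodic_of_isRecurrentWord {w : ℕ → ℤ} {m Q : ℕ}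
    (hper : ∀ n, w (m + n + Q) = w (m + n)) (hrec : IsRecurrentWord w) (n : ℕ) :
    w (n + Q) = w n := by
  -- A factor of length `Q + 1` contains both `w n` and `w (n + Q)`; it recurs beyond `m`, where the
  -- period holds.
  obtain ⟨j, hj, h⟩ := hrec n (Q + 1) m
  obtain ⟨l, rfl⟩ := Nat.exists_eq_add_of_le hj
  have h0 := h 0 (by omega)
  simp only [add_zero] at h0
  rw [← h Q (by omega), hper, h0]

theorem letterCount_eq_factorSum {w : ℕ → ℤ} {a : ℤ} (hw : ∀ n, w n = a ∨ w n = a + 1)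
    (i n : ℕ) : (letterCount w (a + 1) i n : ℤ) = factorSum w i n - n * a := by
  have : ∀ t, (if w (i + t) = a + 1 then (1 : ℤ) else 0) = w (i + t) - a := by
    intro t
    rcases hw (i + t) with h | h <;> simp [h]
  rw [letterCount, Finset.card_filter]
  push_cast
  rw [Finset.sum_congr rfl fun t _ => this t, Finset.sum_sub_distrib]
  simp [factorSum]

/-- Factors of length 1 force two consecutive letters `a`, `a + 1`, and then letter sums count the
larger one up to a constant. -/
theorem isBalancedWord_of_factorSum {w : ℕ → ℤ}
    (hbal : ∀ i j n, factorSum w i n - factorSum w j n ≤ 1) (hne : ∃ i j, w i ≠ w j) :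
    IsBalancedWord w := by
  have hd : ∀ i j, w i - w j ≤ 1 := fun i j => by simpa [factorSum] using hbal i j 1
  obtain ⟨i, j, hij⟩ : ∃ i j, w i < w j := by
    obtain ⟨i, j, h⟩ := hne
    rcases lt_or_gt_of_ne h with h | h
    exacts [⟨i, j, h⟩, ⟨j, i, h⟩]
  have hj : w j = w i + 1 := by linarith [hd j i, Int.add_one_le_iff.2 hij]
  have hmem : ∀ n, w n = w i ∨ w n = w i + 1 := fun n => by
    have := hd n i
    have := hd j n
    omega
  refine ⟨w i, w i + 1, by omega, ?_, fun k l n => ?_⟩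
  · ext c
    constructor
    · rintro ⟨n, rfl⟩
      exact hmem n
    · rintro (rfl | rfl)
      exacts [⟨i, rfl⟩, ⟨j, hj⟩]
  · rw [letterCount_eq_factorSum hmem, letterCount_eq_factorSum hmem, abs_le]
    constructor <;> linarith [hbal k l n, hbal l k n]

/-! ### Orbits and digits. -/

section BetaBar

variable {β x : ℝ}

theorem upperFract_mem (t : ℝ) : upperFract t ∈ Set.Ioc (0 : ℝ) 1 := by
  unfold upperFract
  split_ifs with h
  · simp
  · exact ⟨lt_of_le_of_ne (Int.fract_nonneg t) (Ne.symm h), (Int.fract_lt_one t).le⟩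

theorem upperFract_eq (t : ℝ) : upperFract t = t - (⌈t⌉ - 1) := by
  unfold upperFract
  split_ifs with h
  · obtain ⟨z, rfl⟩ := Int.fract_eq_zero_iff.1 h
    simp
  · rw [Int.ceil_eq_add_one_sub_fract h]
    ring

theorem iterate_betaBarMap_succ (β x : ℝ) (n : ℕ) :
    (betaBarMap β)^[n + 1] x = β * (betaBarMap β)^[n] x - betaBarExpansion β x n := by
  rw [Function.iterate_succ_apply', betaBarMap, upperFract_eq, betaBarExpansion]
  push_cast
  rfl

theorem iterate_betaBarMap_mem (hx : x ∈ Set.Ioc (0 : ℝ) 1) (n : ℕ) :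
    (betaBarMap β)^[n] x ∈ Set.Ioc (0 : ℝ) 1 := by
  cases n with
  | zero => exact hx
  | succ n => rw [Function.iterate_succ_apply']; exact upperFract_mem _

theorem betaBarExpansion_nonneg (hβ : 0 < β) (hx : x ∈ Set.Ioc (0 : ℝ) 1) (n : ℕ) :
    0 ≤ betaBarExpansion β x n := by
  have := Int.ceil_pos.2 (mul_pos hβ (iterate_betaBarMap_mem (β := β) hx n).1)
  unfold betaBarExpansion
  omega

theorem betaBarExpansion_le {b : ℕ} (hx : x ∈ Set.Ioc (0 : ℝ) 1) (n : ℕ) :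
    betaBarExpansion b x n ≤ (b : ℤ) - 1 := by
  have h : ⌈(b : ℝ) * (betaBarMap b)^[n] x⌉ ≤ (b : ℤ) := by
    rw [Int.ceil_le]
    push_cast
    exact mul_le_of_le_one_right (by positivity) (iterate_betaBarMap_mem hx n).2
  unfold betaBarExpansion
  omega

/-- Truncated expansion of an iterate, as an exact identity. -/
theorem pow_mul_eq_sum_add_iterate (β x : ℝ) (n : ℕ) :
    β ^ n * x = ∑ i ∈ Finset.range n, (betaBarExpansion β x i : ℝ) * β ^ (n - 1 - i) +
      (betaBarMap β)^[n] x := by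
  induction n with
  | zero => simp
  | succ n ih =>
    rw [pow_succ', mul_assoc, ih, iterate_betaBarMap_succ, Finset.sum_range_succ, mul_add,
      Finset.mul_sum]
    have : ∀ i ∈ Finset.range n, β * ((betaBarExpansion β x i : ℝ) * β ^ (n - 1 - i)) =
        (betaBarExpansion β x i : ℝ) * β ^ (n + 1 - 1 - i) := fun i hi => by
      have := Finset.mem_range.1 hi
      rw [show n + 1 - 1 - i = (n - 1 - i) + 1 by omega]
      ring
    rw [Finset.sum_congr rfl this]
    simp

/-- Two iterates separate by the factor `β` per step as long as their digits agree. -/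
theorem iterate_sub_iterate_of_agree {i j k : ℕ}
    (h : ∀ t < k, betaBarExpansion β x (i + t) = betaBarExpansion β x (j + t)) :
    (betaBarMap β)^[i + k] x - (betaBarMap β)^[j + k] x =
      β ^ k * ((betaBarMap β)^[i] x - (betaBarMap β)^[j] x) := by
  induction k with
  | zero => simp
  | succ k ih =>
    rw [← add_assoc, ← add_assoc, iterate_betaBarMap_succ, iterate_betaBarMap_succ,
      h k (by omega), pow_succ', mul_assoc, ← ih fun t ht => h t (by omega)]
    ring

/-- Distinct points with equal digits would separate like `β ^ k`, yet the orbit stays in `(0,1]`.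
-/
theorem iterate_eq_of_agree (hβ : 1 < β) (hx : x ∈ Set.Ioc (0 : ℝ) 1) {i j : ℕ}
    (h : ∀ t, betaBarExpansion β x (i + t) = betaBarExpansion β x (j + t)) :
    (betaBarMap β)^[i] x = (betaBarMap β)^[j] x := by
  by_contra hne
  have hpos : 0 < |(betaBarMap β)^[i] x - (betaBarMap β)^[j] x| := abs_pos.2 (sub_ne_zero.2 hne)
  obtain ⟨k, hk⟩ := pow_unbounded_of_one_lt
    (1 / |(betaBarMap β)^[i] x - (betaBarMap β)^[j] x|) hβ
  rw [div_lt_iff₀ hpos] at hk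
  have h1 := iterate_sub_iterate_of_agree (k := k) fun t _ => h t
  have h2 : |(betaBarMap β)^[i + k] x - (betaBarMap β)^[j + k] x| ≤ 1 := by
    obtain ⟨a1, a2⟩ := iterate_betaBarMap_mem (β := β) hx (i + k)
    obtain ⟨b1, b2⟩ := iterate_betaBarMap_mem (β := β) hx (j + k)
    rw [abs_le]
    constructor <;> linarith
  rw [h1, abs_mul, abs_of_pos (by positivity : (0 : ℝ) < β ^ k)] at h2
  linarith

theorem iterate_lt_iterate_of_digit_lt (hβ : 0 < β) {i j : ℕ}
    (h : betaBarExpansion β x i < betaBarExpansion β x j) :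
    (betaBarMap β)^[i] x < (betaBarMap β)^[j] x := by
  by_contra! hle
  have := Int.ceil_mono (mul_le_mul_of_nonneg_left hle hβ.le)
  unfold betaBarExpansion at h
  omega

theorem iterate_sub_le_orbitDiam (hx : x ∈ Set.Icc (0 : ℝ) 1) (i j : ℕ) :
    (betaBarMap β)^[i] x - (betaBarMap β)^[j] x ≤ orbitDiam β x := by
  have hmem : ∀ n, (betaBarMap β)^[n] x ∈ Set.Icc (0 : ℝ) 1 := fun n => by
    cases n with
    | zero => exact hx
    | succ n =>
      rw [Function.iterate_succ_apply']
      exact Set.Ioc_subset_Icc_self (upperFract_mem _)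
  have h1 := le_ciSup (f := fun n => (betaBarMap β)^[n] x)
    ⟨1, by rintro _ ⟨n, rfl⟩; exact (hmem n).2⟩ i
  have h2 := ciInf_le (f := fun n => (betaBarMap β)^[n] x)
    ⟨0, by rintro _ ⟨n, rfl⟩; exact (hmem n).1⟩ j
  exact sub_le_sub h1 h2

theorem betaBarExpansion_sub_le_one (hβ : 2 ≤ β)
    (hd : ∀ i j, (betaBarMap β)^[i] x - (betaBarMap β)^[j] x ≤ 1 / β) (i j : ℕ) :
    betaBarExpansion β x i - betaBarExpansion β x j ≤ 1 := by
  have hβ0 : 0 < β := by linarith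
  have h1 := iterate_betaBarMap_succ β x i
  have h2 := iterate_betaBarMap_succ β x j
  have h3 : β * ((betaBarMap β)^[i] x - (betaBarMap β)^[j] x) ≤ 1 := by
    have := mul_le_mul_of_nonneg_left (hd i j) hβ0.le
    rwa [mul_one_div_cancel hβ0.ne'] at this
  have h4 := hd (j + 1) (i + 1)
  have h5 : 1 / β < 1 := by rw [div_lt_one hβ0]; linarith
  have h6 : ((betaBarExpansion β x i - betaBarExpansion β x j : ℤ) : ℝ) < (2 : ℤ) := by
    push_cast
    linarith
  have := Int.cast_lt.1 h6
  omega

/-- No word `u` occurs both between two small letters and between two large ones. -/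
theorem not_digit_lt_of_agree (hβ : 2 ≤ β)
    (hd : ∀ i j, (betaBarMap β)^[i] x - (betaBarMap β)^[j] x ≤ 1 / β) {i j k : ℕ}
    (h0 : betaBarExpansion β x j < betaBarExpansion β x i)
    (h : ∀ t < k, betaBarExpansion β x (i + 1 + t) = betaBarExpansion β x (j + 1 + t)) :
    ¬ betaBarExpansion β x (j + 1 + k) < betaBarExpansion β x (i + 1 + k) := by
  intro hk
  have hβ0 : 0 < β := by linarith
  have h1 := iterate_lt_iterate_of_digit_lt hβ0 hk
  rw [← sub_pos, iterate_sub_iterate_of_agree h] at h1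
  have h2 := pos_of_mul_pos_right h1 (by positivity)
  rw [iterate_betaBarMap_succ, iterate_betaBarMap_succ] at h2
  have h3 : β * ((betaBarMap β)^[i] x - (betaBarMap β)^[j] x) ≤ 1 := by
    have := mul_le_mul_of_nonneg_left (hd i j) hβ0.le
    rwa [mul_one_div_cancel hβ0.ne'] at this
  have h4 : (betaBarExpansion β x j : ℝ) + 1 ≤ betaBarExpansion β x i := by exact_mod_cast h0
  linarith

theorem factorSum_betaBarExpansion_sub_le_one (hβ : 2 ≤ β)
    (hd : ∀ i j, (betaBarMap β)^[i] x - (betaBarMap β)^[j] x ≤ 1 / β)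
    (n : ℕ) : ∀ i j,
    factorSum (betaBarExpansion β x) i n - factorSum (betaBarExpansion β x) j n ≤ 1 := by
  induction n using Nat.strong_induction_on with
  | _ n ih =>
  intro i j
  set e := betaBarExpansion β x with he
  have hd1 : ∀ i j, e i - e j ≤ 1 := betaBarExpansion_sub_le_one hβ hd
  rcases Nat.eq_zero_or_pos n with rfl | hn
  · simp [factorSum]
  obtain ⟨l, rfl⟩ : ∃ l, n = 1 + l := Nat.exists_eq_add_of_le hn
  rw [factorSum_add, factorSum_add]
  have e1 : ∀ i, factorSum e i 1 = e i := fun i => by simp [factorSum]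
  rw [e1, e1]
  by_cases hij : e j < e i
  swap
  · linarith [ih l (by omega) (i + 1) (j + 1)]
  have hji := hd1 i j
  by_cases hagree : ∀ t < l, e (i + 1 + t) = e (j + 1 + t)
  · have : factorSum e (i + 1) l = factorSum e (j + 1) l :=
      Finset.sum_congr rfl fun t ht => hagree t (Finset.mem_range.1 ht)
    linarith
  push Not at hagree
  classical
  let k := Nat.find hagree
  obtain ⟨hkl, hk⟩ : k < l ∧ e (i + 1 + k) ≠ e (j + 1 + k) := Nat.find_spec hagree
  have hmin : ∀ t < k, e (i + 1 + t) = e (j + 1 + t) := fun t ht => by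
    by_contra hne
    exact Nat.find_min hagree ht ⟨ht.trans hkl, hne⟩
  have hnot := not_digit_lt_of_agree hβ hd hij hmin
  rw [← he] at hnot
  have hsum : factorSum e (i + 1) k = factorSum e (j + 1) k :=
    Finset.sum_congr rfl fun t ht => hmin t (Finset.mem_range.1 ht)
  obtain ⟨r, hr⟩ := Nat.exists_eq_add_of_le (Nat.succ_le_of_lt hkl)
  -- The excess 1 of the first letter is cancelled by the deficit at position `k`; induction bounds
  -- what follows.
  have hrest := ih r (by omega) (i + 1 + (k + 1)) (j + 1 + (k + 1))
  have hki := hd1 (i + 1 + k) (j + 1 + k)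
  rw [hr, Nat.succ_eq_add_one, factorSum_add e (i + 1), factorSum_add e (j + 1),
    factorSum_add e (i + 1), factorSum_add e (j + 1), e1, e1, hsum]
  omega

end BetaBar

/-! ### Rational points and the conclusion. -/

/-- The orbit of a rational number has bounded denominators, so it is eventually periodic. -/
theorem exists_iterate_eq_of_rat (b : ℕ) {x : ℝ} (hx : x ∈ Set.Ioc (0 : ℝ) 1) {r : ℚ}
    (hr : (r : ℝ) = x) :
    ∃ m Q : ℕ, 1 ≤ Q ∧ (betaBarMap b)^[m + Q] x = (betaBarMap b)^[m] x := by
  have hden : (0 : ℝ) < r.den := by exact_mod_cast r.pos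
  have hint : ∀ n, ∃ z : ℤ, (betaBarMap b)^[n] x * r.den = z := fun n => by
    induction n with
    | zero =>
      refine ⟨r.num, ?_⟩
      rw [Function.iterate_zero_apply, ← hr]
      exact_mod_cast Rat.mul_den_eq_num r
    | succ n ih =>
      obtain ⟨z, hz⟩ := ih
      refine ⟨b * z - betaBarExpansion b x n * r.den, ?_⟩
      rw [iterate_betaBarMap_succ]
      push_cast
      rw [← hz]
      ring
  choose z hz using hint
  have hmem : ∀ n, z n ∈ Set.Icc (0 : ℤ) r.den := fun n => by
    obtain ⟨h1, h2⟩ := iterate_betaBarMap_mem (β := b) hx n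
    have h3 := hz n
    have h4 : (0 : ℝ) ≤ z n := by rw [← h3]; positivity
    have h5 : (z n : ℝ) ≤ r.den := by
      rw [← h3]
      exact mul_le_of_le_one_left hden.le h2
    exact ⟨by exact_mod_cast h4, by exact_mod_cast h5⟩
  obtain ⟨i, j, hij, h⟩ : ∃ i j, i < j ∧ z i = z j := by
    obtain ⟨i, -, j, -, hne, h⟩ := Set.infinite_univ.exists_ne_map_eq_of_mapsTo
      (f := z) (t := Set.Icc 0 (r.den : ℤ)) (fun n _ => hmem n) (Set.finite_Icc _ _)
    rcases lt_or_gt_of_ne hne with h' | h'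
    exacts [⟨i, j, h', h⟩, ⟨j, i, h', h.symm⟩]
  obtain ⟨Q, rfl⟩ := Nat.exists_eq_add_of_le hij.le
  refine ⟨i, Q, by omega, mul_right_cancel₀ hden.ne' ?_⟩
  rw [hz, hz, h]

theorem iterate_betaBarMap_add_eq {β x : ℝ} {m Q : ℕ}
    (h : (betaBarMap β)^[m + Q] x = (betaBarMap β)^[m] x) (n : ℕ) :
    betaBarExpansion β x (m + n + Q) = betaBarExpansion β x (m + n) := by
  unfold betaBarExpansion
  rw [show m + n + Q = n + (m + Q) by ring, add_comm m n, Function.iterate_add_apply, h,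
    ← Function.iterate_add_apply]

/-- The value of a rational number with eventually periodic expansion. -/
theorem eq_floor_add_of_eventually_periodic {b : ℕ} (hb : 2 ≤ b) {ξ : ℚ}
    (hx : Int.fract (ξ : ℝ) ∈ Set.Ioc (0 : ℝ) 1) {e : ℕ → ℤ}
    (he : e = betaBarExpansion b (Int.fract (ξ : ℝ))) {m q : ℕ} (hq : 1 ≤ q)
    (hper : ∀ n, e (m + n + q) = e (m + n)) :
    ξ = (⌊ξ⌋ : ℚ) +
        (∑ i ∈ Finset.range (m + q), (e i : ℚ) * (b : ℚ) ^ (m + q - 1 - i) -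
          ∑ i ∈ Finset.range m, (e i : ℚ) * (b : ℚ) ^ (m - 1 - i)) /
        ((b : ℚ) ^ m * ((b : ℚ) ^ q - 1)) := by
  have hb1 : (1 : ℝ) < b := by exact_mod_cast hb
  have hiter := iterate_eq_of_agree hb1 hx (i := m + q) (j := m) fun t => by
    rw [← he, ← hper t, add_right_comm]
  have h1 := pow_mul_eq_sum_add_iterate b (Int.fract (ξ : ℝ)) (m + q)
  have h2 := pow_mul_eq_sum_add_iterate b (Int.fract (ξ : ℝ)) m
  rw [hiter] at h1
  rw [← he] at h1 h2
  have hpow : (1 : ℚ) < (b : ℚ) ^ q := one_lt_pow₀ (by exact_mod_cast hb) (by omega)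
  have hpos : (0 : ℚ) < (b : ℚ) ^ m * ((b : ℚ) ^ q - 1) :=
    mul_pos (pow_pos (by positivity) _) (by linarith)
  -- The iterates at `m + q` and `m` coincide, so they cancel on subtraction.
  have h3 : Int.fract (ξ : ℝ) * ((b : ℝ) ^ m * ((b : ℝ) ^ q - 1)) =
      ∑ i ∈ Finset.range (m + q), (e i : ℝ) * (b : ℝ) ^ (m + q - 1 - i) -
        ∑ i ∈ Finset.range m, (e i : ℝ) * (b : ℝ) ^ (m - 1 - i) := by
    rw [pow_add] at h1
    linear_combination h1 - h2
  rw [← Rat.cast_fract] at h3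
  have h4 : Int.fract ξ * ((b : ℚ) ^ m * ((b : ℚ) ^ q - 1)) =
      ∑ i ∈ Finset.range (m + q), (e i : ℚ) * (b : ℚ) ^ (m + q - 1 - i) -
        ∑ i ∈ Finset.range m, (e i : ℚ) * (b : ℚ) ^ (m - 1 - i) := by
    exact_mod_cast h3
  rw [← h4, mul_div_cancel_right₀ _ hpos.ne', Int.floor_add_fract]

/-- The point 0 is excluded since it maps to 1, giving diameter at least `1 > 1/b`. -/
theorem fract_mem_of_orbitDiam_le {b : ℕ} (hb : 2 ≤ b) {t : ℝ}
    (hdiam : orbitDiam b (Int.fract t) ≤ 1 / (b : ℝ)) : Int.fract t ∈ Set.Ioc (0 : ℝ) 1 := by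
  refine ⟨lt_of_le_of_ne (Int.fract_nonneg t) fun h0 => ?_, (Int.fract_lt_one t).le⟩
  have hb2 : (2 : ℝ) ≤ b := by exact_mod_cast hb
  have h := iterate_sub_le_orbitDiam (β := b) (x := Int.fract t) (by rw [← h0]; simp) 1 0
  rw [← h0] at h hdiam
  simp only [Function.iterate_one, betaBarMap, upperFract, mul_zero, Int.fract_zero, if_true,
    Function.iterate_zero, id, sub_zero] at h
  have h1 : 1 / (b : ℝ) < 1 := by rw [div_lt_one (by linarith)]; linarith
  linarith

theorem corollary8 (β : ℕ) (hβ : 2 ≤ β) (ξ : ℚ)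
    (hdiam : orbitDiam (β : ℝ) (Int.fract (ξ : ℝ)) ≤ 1 / (β : ℝ))
    (e : ℕ → ℤ) (he : e = betaBarExpansion (β : ℝ) (Int.fract (ξ : ℝ))) :
    (∃ p q : ℕ, 1 ≤ q ∧ p.Coprime q ∧ (p : ℚ) / (q : ℚ) ≤ (β : ℚ) - 1 ∧
      (∀ n, e (n + q) = e n) ∧
      IsMechanicalWord e (((p : ℚ) / (q : ℚ) : ℚ) : ℝ) ∧
      ξ = (⌊ξ⌋ : ℚ) +
        (∑ i ∈ Finset.range q, (e i : ℚ) * (β : ℚ) ^ (q - 1 - i)) / ((β : ℚ) ^ q - 1)) ∨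
    (∃ p q m : ℕ, 1 ≤ q ∧ 1 ≤ m ∧ p.Coprime q ∧ (p : ℚ) / (q : ℚ) ≤ (β : ℚ) - 1 ∧
      (∀ n, e (m + n + q) = e (m + n)) ∧
      IsSkewWord e ((p : ℚ) / (q : ℚ)) ∧
      ξ = (⌊ξ⌋ : ℚ) +
        (∑ i ∈ Finset.range (m + q), (e i : ℚ) * (β : ℚ) ^ (m + q - 1 - i) -
          ∑ i ∈ Finset.range m, (e i : ℚ) * (β : ℚ) ^ (m - 1 - i)) /
        ((β : ℚ) ^ m * ((β : ℚ) ^ q - 1))) := by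
  have hx := fract_mem_of_orbitDiam_le hβ hdiam
  have hβ2 : (2 : ℝ) ≤ β := by exact_mod_cast hβ
  have hbal : ∀ i j n, factorSum e i n - factorSum e j n ≤ 1 := fun i j n => by
    rw [he]
    exact factorSum_betaBarExpansion_sub_le_one hβ2
      (fun i j => (iterate_sub_le_orbitDiam (Set.Ioc_subset_Icc_self hx) i j).trans hdiam) n i j
  have h0 : ∀ n, 0 ≤ e n := fun n => by
    rw [he]
    exact betaBarExpansion_nonneg (by linarith) hx n
  have hB : ∀ n, e n ≤ ((β - 1 : ℕ) : ℤ) := fun n => by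
    rw [he, Nat.cast_sub (by omega)]
    exact betaBarExpansion_le hx n
  have hcast : ((β - 1 : ℕ) : ℚ) = (β : ℚ) - 1 := by
    rw [Nat.cast_sub (by omega), Nat.cast_one]
  by_cases hpure : ∃ Q, 1 ≤ Q ∧ ∀ n, e (n + Q) = e n
  · left
    obtain ⟨Q, hQ, hper⟩ := hpure
    obtain ⟨p, q, hq, hpq, hle, hperq, hmech⟩ :=
      isMechanicalWord_of_periodic_of_balanced hQ hper hbal h0 hB
    refine ⟨p, q, hq, hpq, hcast ▸ hle, hperq, hmech, ?_⟩
    simpa using eq_floor_add_of_eventually_periodic hβ hx he (m := 0) hq (by simpa using hperq)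
  · right
    obtain ⟨m₀, Q, hQ, hiter⟩ := exists_iterate_eq_of_rat β hx (Rat.cast_fract ξ)
    have hper₀ : ∀ n, e (m₀ + n + Q) = e (m₀ + n) := by
      rw [he]
      exact iterate_betaBarMap_add_eq hiter
    obtain ⟨m, rfl⟩ | rfl : (∃ m, m₀ = m + 1) ∨ m₀ = 0 := by
      cases m₀ <;> simp
    swap
    · exact absurd ⟨Q, hQ, by simpa using hper₀⟩ hpure
    have hper₀' : ∀ n, e (m + 1 + (n + Q)) = e (m + 1 + n) := fun n => by
      rw [← add_assoc, hper₀]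
    obtain ⟨p, q, hq, hpq, hle, hperq, hmech⟩ :=
      isMechanicalWord_of_periodic_of_balanced (w := fun n => e (m + 1 + n)) hQ
        hper₀' (fun i j n => by simpa only [factorSum_shift] using hbal _ _ n)
        (fun n => h0 _) (fun n => hB _)
    have hperq' : ∀ n, e (m + 1 + n + q) = e (m + 1 + n) := fun n => by
      rw [add_assoc (m + 1), hperq]
    refine ⟨p, q, m + 1, hq, by omega, hpq, hcast ▸ hle, hperq', ⟨?_, ?_, m + 1, by omega, hmech⟩,
      eq_floor_add_of_eventually_periodic hβ hx he hq hperq'⟩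
    · refine isBalancedWord_of_factorSum hbal ?_
      -- A constant word would have period 1.
      by_contra! hconst
      exact hpure ⟨1, le_rfl, fun n => hconst _ _⟩
    · exact fun hrec => hpure ⟨Q, hQ, periodic_of_isRecurrentWord hper₀ hrec⟩
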